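/- Let $(X,d)$ be a proper metric space with base point $o$ (closed balls are compact), and put $(x|y):=\tfrac12\bigl(d(x,o)+d(y,o)-d(x,y)\bigr)$. Assume that $X$ is Gromov-hyperbolic: there is $\delta\ge 0$ with $(x|z)\ge\min\{(x|y),(y|z)\}-\delta$ for all $x,y,z\in X$. The boundary $\partial X$ is the set of sequences $(x_i)$ in $X$ with $\lim_{i,j\to\infty}(x_i|x_j)=\infty$, modulo the relation $(x_i)\sim(y_j)\iff\lim_{i,j\to\infty}(x_i|y_j)=\infty$; isometries of $X$ act on it by $\gamma[(x_i)]=[(\gamma x_i)]$. For a set $A$ of isometries of $X$, its critical exponent is $$\delta_A:=\limsup_{n\to\infty}\frac1n\log\#\bigl(B(o,n)\cap Ao\bigr)\in[-\infty,\infty],$$ where $B(o,n)$ is the closed ball. Two subsets $A,B\subseteq X$ are called Gromov-disjoint if their closures in $X$ are disjoint and $(a|b)$ is bounded above for $(a,b)\in A\times B$. A group of isometries of $X$ is called a Schottky group if it is generated by a finite set $G$ of isometries for which there are subsets $X_\gamma^+,X_\gamma^-\subseteq X$ ($\gamma\in G$), all pairwise Gromov-disjoint, such that $\gamma(X\setminus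 X_\gamma^-)\subseteq X_\gamma^+$ for every $\gamma\in G$ and such that $X\setminus\bigcup_{\gamma\in G}(X_\gamma^+\cup X_\gamma^-)$ has non-empty interior. (The set $G=\emptyset$ is allowed, so the trivial group is a Schottky group.) Let $\Gamma$ be a discrete (for the topology of pointwise convergence, equivalently the compact-open topology), torsion-free group of isometries of $X$ that has no global fixed point in $\partial X$. Then $$\sup_{\Gamma'}\ \delta_{\Gamma'}\ \ge\ \tfrac12\,\delta_\Gamma,$$ where the supremum is over all subgroups $\Gamma'$ of $\Gamma$ that are Schottky groups. -/

import Mathlib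

open Set Filter Topology

noncomputable section

variable {X : Type*} [MetricSpace X]

/-- The Gromov product `(x | y)` seen from the base point `o`. -/
def gromovProduct (o x y : X) : ℝ :=
  (dist x o + dist y o - dist x y) / 2

/-- The pointed metric space `(X, o)` is Gromov-hyperbolic. -/
def IsGromovHyperbolic (o : X) : Prop :=
  ∃ δ : ℝ, 0 ≤ δ ∧ ∀ x y z : X,
    min (gromovProduct o x y) (gromovProduct o y z) - δ ≤ gromovProduct o x z

/-- `(x_i | y_j)` tends to infinity as `i, j → ∞`. -/
def GromovAsymptotic (o : X) (x y : ℕ → X) : Prop :=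
  Tendsto (fun p : ℕ × ℕ => gromovProduct o (x p.1) (y p.2)) atTop atTop

/-- Sequences converging at infinity: `(x_i | x_j) → ∞` as `i, j → ∞`. -/
def GromovSequence (o : X) : Type _ :=
  {x : ℕ → X // GromovAsymptotic o x x}

theorem gromovProduct_comm (o x y : X) : gromovProduct o x y = gromovProduct o y x := by
  simp only [gromovProduct, dist_comm x y, add_comm (dist x o)]

theorem GromovAsymptotic.symm {o : X} {x y : ℕ → X} (h : GromovAsymptotic o x y) :
    GromovAsymptotic o y x := by
  unfold GromovAsymptotic at *
  rw [← prod_atTop_atTop_eq] at *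
  have := h.comp tendsto_prod_swap
  refine this.congr fun p => ?_
  exact gromovProduct_comm _ _ _

theorem GromovAsymptotic.trans {o : X} (ho : IsGromovHyperbolic o) {x y z : ℕ → X}
    (h₁ : GromovAsymptotic o x y) (h₂ : GromovAsymptotic o y z) :
    GromovAsymptotic o x z := by
  obtain ⟨δ, -, hδ⟩ := ho
  unfold GromovAsymptotic at *
  rw [tendsto_atTop] at *
  intro b
  obtain ⟨p, hp⟩ := eventually_atTop.1 (h₁ (b + δ))
  obtain ⟨q, hq⟩ := eventually_atTop.1 (h₂ (b + δ))
  refine eventually_atTop.2 ⟨(p.1, q.2), fun r hr => ?_⟩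
  have a₁ := hp (r.1, max p.2 q.1) ⟨hr.1, le_max_left _ _⟩
  have a₂ := hq (max p.2 q.1, r.2) ⟨le_max_right _ _, hr.2⟩
  have a₃ := hδ (x r.1) (y (max p.2 q.1)) (z r.2)
  have a₄ := le_min a₁ a₂
  linarith

/-- Two sequences converging at infinity are equivalent if `(x_i | y_j) → ∞`. -/
def gromovSetoid {o : X} (ho : IsGromovHyperbolic o) : Setoid (GromovSequence o) where
  r x y := GromovAsymptotic o x.1 y.1
  iseqv := ⟨fun x => x.2, fun h => h.symm, fun h₁ h₂ => h₁.trans ho h₂⟩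

/-- The Gromov boundary of a Gromov-hyperbolic space. -/
def GromovBoundary {o : X} (ho : IsGromovHyperbolic o) : Type _ :=
  Quotient (gromovSetoid ho)

theorem GromovAsymptotic.map {o : X} (γ : X ≃ᵢ X) {x y : ℕ → X}
    (h : GromovAsymptotic o x y) :
    GromovAsymptotic o (fun i => γ (x i)) (fun i => γ (y i)) := by
  unfold GromovAsymptotic at *
  refine tendsto_atTop_mono (fun p => ?_) (tendsto_atTop_add_const_right _ (-dist (γ o) o) h)
  have h₁ := dist_triangle (γ (x p.1)) o (γ o)
  have h₂ := dist_triangle (γ (y p.2)) o (γ o)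
  simp only [gromovProduct, γ.isometry.dist_eq, dist_comm o (γ o)] at *
  linarith

/-- The action of an isometry on the boundary, `[x_i] ↦ [γ x_i]`. -/
def boundaryMap {o : X} (ho : IsGromovHyperbolic o) (γ : X ≃ᵢ X) :
    GromovBoundary ho → GromovBoundary ho :=
  Quotient.map' (s₁ := gromovSetoid ho) (s₂ := gromovSetoid ho)
    (fun x => ⟨fun i => γ (x.1 i), x.2.map γ⟩) fun _ _ h => GromovAsymptotic.map γ h

/-- `Γ` has a global fixed point in the Gromov boundary. -/
def FixesBoundaryPoint {o : X} (ho : IsGromovHyperbolic o) (Γ : Subgroup (X ≃ᵢ X)) : Prop :=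
  ∃ ξ : GromovBoundary ho, ∀ γ ∈ Γ, boundaryMap ho γ ξ = ξ

/-- `Γ` is discrete for the topology of pointwise convergence, which on isometry groups is
the compact-open topology. -/
def IsDiscreteIsometryGroup (Γ : Subgroup (X ≃ᵢ X)) : Prop :=
  IsDiscrete ((fun γ : X ≃ᵢ X => (γ : X → X)) '' (Γ : Set (X ≃ᵢ X)))

/-- The only element of finite order is the identity. -/
def IsTorsionFreeSubgroup {G : Type*} [Group G] (Γ : Subgroup G) : Prop :=
  ∀ γ ∈ Γ, IsOfFinOrder γ → γ = 1

/-- The critical exponent of a subset `P` of `X`: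
`limsup (1/n) log #(B(o, n) ∩ P)`, an extended real number. -/
def criticalExponentSet (o : X) (P : Set X) : EReal :=
  limsup (fun n : ℕ =>
    (((1 / n : ℝ)) : EReal) *
      ENNReal.log (((Metric.closedBall o (n : ℝ) ∩ P).encard : ENat) : ENNReal)) atTop

/-- The critical exponent of a set of isometries is that of the orbit of `o`. -/
def criticalExponent (o : X) (A : Set (X ≃ᵢ X)) : EReal :=
  criticalExponentSet o ((fun γ : X ≃ᵢ X => γ o) '' A)

/-- `A` and `B` have disjoint closures and `(a | b)` is bounded above on `A × B`. -/
def GromovDisjoint (o : X) (A B : Set X) : Prop :=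
  Disjoint (closure A) (closure B) ∧
    ∃ C : ℝ, 0 < C ∧ ∀ a ∈ A, ∀ b ∈ B, gromovProduct o a b ≤ C

/-- The set `G` generates a Schottky group: `G` is finite and there are subsets `P γ`
(attracting) and `M γ` (repelling), for `γ ∈ G`, playing ping-pong. -/
def IsSchottkyGenerating (o : X) (G : Set (X ≃ᵢ X)) : Prop :=
  G.Finite ∧ ∃ P M : G → Set X,
    (Pairwise fun i j : G ⊕ G =>
      GromovDisjoint o (Sum.elim P M i) (Sum.elim P M j)) ∧
    (∀ γ : G, (γ : X ≃ᵢ X) '' (M γ)ᶜ ⊆ P γ) ∧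
    (interior (⋃ γ : G, (P γ ∪ M γ))ᶜ).Nonempty

/-- A Schottky group of isometries. -/
def IsSchottkyGroup (o : X) (Γ : Subgroup (X ≃ᵢ X)) : Prop :=
  ∃ G : Set (X ≃ᵢ X), IsSchottkyGenerating o G ∧ Γ = Subgroup.closure G

end

/-! Long conjugates of one hyperbolic element play ping-pong, and there are about as many of them as
orbit points. If no element of Γ were hyperbolic (`HyperbolicWith.exists_hyperbolic`), any two far
orbit points would have a large Gromov product, so all orbit sequences leaving every ball would
converge to one boundary point, fixed by Γ. So there is a hyperbolic g. Let h be a high power of g.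
For s below the exponent of Γ, some large n has more than exp(sn) elements γ with |γ| := d(γo, o) ≤
n. Three reductions cost only a factor polynomial in n: take γ shortest in its coset γ⟨g⟩, so that
γ⁻¹o points away from both ends of the axis of g; keep one shell m ≤ |γ| ≤ m + 1; keep a separated
subset S. For γ in S the translates by γ of the half-shadows of ho and h⁻¹o are then pairwise
Gromov-disjoint, so the γhγ⁻¹ generate a Schottky group (`ConjugateFamily.isSchottkyGenerating`).
Each has length at most 2n + K with K fixed, so counting positive words gives exponent at least
log|S| / (2n + K), about s/2. The factor 1/2 is the price of conjugating. -/

/-! ### Gromov products, fixed boundary points and powers of hyperbolic elements -/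

section Products

variable {X : Type*} [MetricSpace X] {o : X} {δ : ℝ}

theorem dist_isometryEquiv_apply (γ : X ≃ᵢ X) (x y : X) : dist (γ x) y = dist x (γ⁻¹ y) := by
  rw [← γ.isometry.dist_eq x (γ⁻¹ y), IsometryEquiv.apply_inv_self]

theorem dist_inv_apply_self (γ : X ≃ᵢ X) (x : X) : dist (γ⁻¹ x) x = dist (γ x) x := by
  rw [dist_isometryEquiv_apply γ, dist_comm]

theorem gromovProduct_self (o x : X) : gromovProduct o x x = dist x o := by
  simp [gromovProduct]

theorem gromovProduct_base_left (o x : X) : gromovProduct o o x = 0 := by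
  simp [gromovProduct, dist_comm]

theorem gromovProduct_nonneg (o x y : X) : 0 ≤ gromovProduct o x y := by
  have := dist_triangle_right x y o
  unfold gromovProduct
  linarith

theorem gromovProduct_map_base (o : X) (γ : X ≃ᵢ X) (x : X) :
    gromovProduct o (γ x) (γ o) = dist (γ o) o - gromovProduct o x (γ⁻¹ o) := by
  simp only [gromovProduct, γ.isometry.dist_eq, dist_inv_apply_self, dist_isometryEquiv_apply γ x]
  ring

theorem dist_map_base (o : X) (γ : X ≃ᵢ X) (x : X) :
    dist (γ x) o = dist (γ o) o + dist x o - 2 * gromovProduct o x (γ⁻¹ o) := by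
  simp only [gromovProduct, dist_inv_apply_self, dist_isometryEquiv_apply γ x]
  ring

theorem gromovProduct_map_le (o : X) (γ : X ≃ᵢ X) (x y : X) :
    gromovProduct o (γ x) (γ y) ≤ gromovProduct o x y + dist (γ o) o := by
  have h₁ := dist_triangle (γ x) (γ o) o
  have h₂ := dist_triangle (γ y) (γ o) o
  simp only [gromovProduct, γ.isometry.dist_eq] at *
  linarith

theorem continuous_gromovProduct_left (o y : X) : Continuous fun x => gromovProduct o x y := by
  unfold gromovProduct
  fun_prop

/-- The four-point inequality, for a given constant. -/
def HyperbolicWith (o : X) (δ : ℝ) : Prop :=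
  ∀ x y z : X, min (gromovProduct o x y) (gromovProduct o y z) - δ ≤ gromovProduct o x z

/-- As in a tree: if y follows x beyond the point where z branches off, then z leaves y there too.
-/
theorem HyperbolicWith.le_of_lt (h : HyperbolicWith o δ) {x y z : X}
    (hxy : gromovProduct o x z + δ < gromovProduct o x y) :
    gromovProduct o y z ≤ gromovProduct o x z + δ := by
  have := h x y z
  by_contra! hc
  have := lt_min hxy hc
  linarith

/-- If no element of a group is hyperbolic in a quantitative sense, then any two orbit points
far from the base point have a large Gromov product. -/
theorem HyperbolicWith.le_gromovProduct_orbit (hδ : HyperbolicWith o δ) (h0 : 0 ≤ δ)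
    {Γ : Subgroup (X ≃ᵢ X)} {C : ℝ} (hC : 0 ≤ C)
    (hΓ : ∀ g ∈ Γ, dist (g o) o / 2 - C ≤ gromovProduct o (g o) (g⁻¹ o))
    {g h : X ≃ᵢ X} (hg : g ∈ Γ) (hh : h ∈ Γ) :
    min (dist (g o) o) (dist (h o) o) / 2 - (C + 3 * δ) ≤ gromovProduct o (g o) (h o) := by
  by_contra! hlt
  set t := gromovProduct o (g o) (h o) with ht
  have m₁ := min_le_left (dist (g o) o) (dist (h o) o)
  have m₂ := min_le_right (dist (g o) o) (dist (h o) o)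
  -- If go and ho diverge early, gh has little cancellation: gho follows go and (gh)⁻¹o follows
  -- h⁻¹o. Applying `hΓ` to gh then brings go and h⁻¹o together, against `a₂`.
  have a₁ : gromovProduct o (g⁻¹ o) (h o) ≤ t + δ := by
    apply hδ.le_of_lt
    have := hΓ g hg
    linarith
  have a₂ : gromovProduct o (h⁻¹ o) (g o) ≤ t + δ := by
    have := hδ.le_of_lt (x := h o) (y := h⁻¹ o) (z := g o)
    rw [gromovProduct_comm o (h o) (g o), ← ht] at this
    apply this
    have := hΓ h hh
    linarith
  have b₁ := dist_map_base o g (h o)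
  have b₂ := gromovProduct_map_base o g (h o)
  have b₃ := gromovProduct_map_base o h⁻¹ (g⁻¹ o)
  have b₄ := hΓ (g * h) (Γ.mul_mem hg hh)
  rw [gromovProduct_comm] at a₁
  rw [inv_inv, dist_inv_apply_self, gromovProduct_comm o (g⁻¹ o)] at b₃
  simp only [mul_inv_rev, IsometryEquiv.mul_apply] at b₄
  have c₁ := hδ (g o) (g (h o)) (h⁻¹ o)
  have c₂ := hδ (g (h o)) (h⁻¹ (g⁻¹ o)) (h⁻¹ o)
  rw [gromovProduct_comm o (g o) (g (h o))] at c₁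
  rw [gromovProduct_comm o (g o) (h⁻¹ o)] at c₁
  have d₂ : min (dist (g o) o) (dist (h o) o) - t - δ - C - δ ≤
      gromovProduct o (g (h o)) (h⁻¹ o) := by
    refine le_trans (sub_le_sub_right (le_min ?_ ?_) _) c₂ <;> linarith
  have d₁ : min (dist (g o) o) (dist (h o) o) - t - δ - C - δ - δ ≤
      gromovProduct o (h⁻¹ o) (g o) := by
    refine le_trans (sub_le_sub_right (le_min ?_ ?_) _) c₁ <;> linarith
  linarith

theorem fixesBoundaryPoint_of_le_gromovProduct (ho : IsGromovHyperbolic o)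
    {Γ : Subgroup (X ≃ᵢ X)} {C : ℝ}
    (hΓ : ∀ g ∈ Γ, ∀ h ∈ Γ,
      min (dist (g o) o) (dist (h o) o) / 2 - C ≤ gromovProduct o (g o) (h o))
    (hunb : ∀ R : ℝ, ∃ g ∈ Γ, R ≤ dist (g o) o) : FixesBoundaryPoint ho Γ := by
  choose g hg hgn using fun n : ℕ => hunb n
  have key : ∀ γ ∈ Γ, GromovAsymptotic o (fun i => γ (g i o)) fun i => g i o := by
    intro γ hγ
    refine tendsto_atTop.2 fun b => ?_
    set r := 2 * (b + C) + dist (γ o) o with hr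
    refine eventually_atTop.2 ⟨(⌈r⌉₊, ⌈r⌉₊), fun p hp => ?_⟩
    have h₁ : r ≤ p.1 := Nat.ceil_le.1 hp.1
    have h₂ : r ≤ p.2 := Nat.ceil_le.1 hp.2
    have h₃ := hΓ (γ * g p.1) (Γ.mul_mem hγ (hg _)) (g p.2) (hg _)
    have h₄ := hgn p.1
    have h₅ := hgn p.2
    have h₆ := dist_triangle_right (γ o) (γ (g p.1 o)) o
    rw [γ.isometry.dist_eq, dist_comm o] at h₆
    simp only [IsometryEquiv.mul_apply] at h₃
    refine le_trans ?_ h₃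
    have h₇ : 2 * (b + C) ≤ min (dist (γ (g p.1 o)) o) (dist (g p.2 o) o) := by
      have := dist_nonneg (x := γ o) (y := o)
      apply le_min <;> linarith
    linarith
  refine ⟨Quotient.mk (gromovSetoid ho) ⟨fun i => g i o, ?_⟩, fun γ hγ => ?_⟩
  · simpa using key 1 Γ.one_mem
  · exact Quotient.sound (s := gromovSetoid ho) (key γ hγ)

/-- The two bounds feed each other: little cancellation against g⁻¹o lets the next power grow and
keeps it in the direction of go, hence away from g⁻¹o. -/
theorem HyperbolicWith.pow_estimates (hδ : HyperbolicWith o δ) (h0 : 0 ≤ δ) {g : X ≃ᵢ X}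
    (hg : gromovProduct o (g o) (g⁻¹ o) < dist (g o) o / 2 - (2 * δ + 1)) (k : ℕ) :
    (k : ℝ) ≤ dist ((g ^ k) o) o ∧
    gromovProduct o ((g ^ k) o) (g⁻¹ o) ≤ gromovProduct o (g o) (g⁻¹ o) + δ := by
  induction k with
  | zero =>
    have := gromovProduct_nonneg o (g o) (g⁻¹ o)
    simp only [pow_zero, IsometryEquiv.coe_one, id, dist_self, Nat.cast_zero, le_refl, true_and,
      gromovProduct_base_left]
    linarith
  | succ k ih =>
    obtain ⟨ih₁, ih₂⟩ := ih
    rw [pow_succ', IsometryEquiv.mul_apply]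
    have h₁ := dist_map_base o g ((g ^ k) o)
    have h₂ := gromovProduct_map_base o g ((g ^ k) o)
    rw [gromovProduct_comm] at h₂
    refine ⟨?_, hδ.le_of_lt ?_⟩
    · push_cast
      linarith
    · linarith

theorem HyperbolicWith.le_gromovProduct_pow (hδ : HyperbolicWith o δ) (h0 : 0 ≤ δ) {g : X ≃ᵢ X}
    (hg : gromovProduct o (g o) (g⁻¹ o) < dist (g o) o / 2 - (2 * δ + 1)) {k : ℕ} (hk : k ≠ 0) :
    dist (g o) o / 2 + δ < gromovProduct o (g o) ((g ^ k) o) := by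
  obtain ⟨k, rfl⟩ := Nat.exists_eq_succ_of_ne_zero hk
  have h₁ := (hδ.pow_estimates h0 hg k).2
  have h₂ := gromovProduct_map_base o g ((g ^ k) o)
  rw [Nat.succ_eq_add_one, pow_succ', IsometryEquiv.mul_apply, gromovProduct_comm]
  linarith

/-- A sufficiently long element translating along an axis: its powers stay away from every point
that is at least as close to the base point as to the rest of the orbit of the axis. -/
theorem HyperbolicWith.exists_separating_power (hδ : HyperbolicWith o δ) (h0 : 0 ≤ δ)
    {g : X ≃ᵢ X}
    (hg : gromovProduct o (g o) (g⁻¹ o) < dist (g o) o / 2 - (2 * δ + 1)) :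
    (∀ j : ℤ, |(j : ℝ)| ≤ dist ((g ^ j) o) o) ∧
    ∃ D : ℝ, ∀ k : ℕ, k ≠ 0 → gromovProduct o ((g ^ k) o) ((g ^ k)⁻¹ o) ≤ D ∧
      ∀ x, (∀ j : ℤ, dist x o ≤ dist x ((g ^ j) o)) →
        gromovProduct o ((g ^ k) o) x ≤ D ∧ gromovProduct o ((g ^ k)⁻¹ o) x ≤ D := by
  have hg' : gromovProduct o (g⁻¹ o) (g⁻¹⁻¹ o) < dist (g⁻¹ o) o / 2 - (2 * δ + 1) := by
    rwa [inv_inv, gromovProduct_comm, dist_inv_apply_self]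
  -- A point x nearer to o than to fo leaves fo by |f|/2, while every power of f follows fo further.
  -- The bound is independent of k, so k may be chosen after D.
  have aux : ∀ f : X ≃ᵢ X,
      gromovProduct o (f o) (f⁻¹ o) < dist (f o) o / 2 - (2 * δ + 1) → ∀ k : ℕ, k ≠ 0 →
      ∀ x, dist x o ≤ dist x (f o) →
        gromovProduct o ((f ^ k) o) x ≤ dist (f o) o / 2 + δ := by
    intro f hf k hk x hx
    have h₁ := hδ.le_gromovProduct_pow h0 hf hk
    have h₂ : gromovProduct o (f o) x ≤ dist (f o) o / 2 := by
      unfold gromovProduct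
      rw [dist_comm (f o) x]
      linarith
    refine (hδ.le_of_lt (x := f o) ?_).trans ?_ <;> linarith
  refine ⟨fun j => ?_, dist (g o) o / 2 + δ, fun k hk => ⟨?_, fun x hx => ⟨?_, ?_⟩⟩⟩
  · obtain ⟨n, rfl | rfl⟩ := j.eq_nat_or_neg
    · simpa using (hδ.pow_estimates h0 hg n).1
    · rw [zpow_neg, dist_inv_apply_self]
      simpa using (hδ.pow_estimates h0 hg n).1
  · have h₁ := hδ.le_gromovProduct_pow h0 hg hk
    have h₂ := hδ.le_gromovProduct_pow h0 hg' hk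
    rw [dist_inv_apply_self, inv_pow] at h₂
    have h₃ : gromovProduct o ((g ^ k) o) (g⁻¹ o) ≤ gromovProduct o (g o) (g⁻¹ o) + δ :=
      hδ.le_of_lt (by linarith)
    have h₄ := hδ.le_of_lt (x := g⁻¹ o) (y := (g ^ k)⁻¹ o) (z := (g ^ k) o)
    rw [gromovProduct_comm o (g⁻¹ o) ((g ^ k) o), gromovProduct_comm o ((g ^ k)⁻¹ o)] at h₄
    have := h₄ (by linarith)
    linarith
  · exact aux g hg k hk x (by simpa using hx 1)
  · have := aux g⁻¹ hg' k hk x (by simpa using hx (-1))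
    rwa [dist_inv_apply_self, inv_pow] at this

end Products

/-! ### Discreteness makes orbit balls finite -/

/-- Discreteness gives a finite F and ε such that only the identity moves every point of F by less
than ε. Restrictions to F lie in a compact product of balls, and an ε/2-net there separates the
elements. -/
theorem finite_orbit_ball {X : Type*} [MetricSpace X] [ProperSpace X]
    {Γ : Subgroup (X ≃ᵢ X)} (hΓ : IsDiscreteIsometryGroup Γ) (o : X) (R : ℝ) :
    {γ : X ≃ᵢ X | γ ∈ Γ ∧ dist (γ o) o ≤ R}.Finite := by
  obtain ⟨F, ε, hε, hF⟩ : ∃ F : Finset X, ∃ ε > 0, ∀ γ ∈ Γ, (∀ x ∈ F, dist (γ x) x < ε) → γ = 1 := by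
    have hmem : (fun x : X => x) ∈ (fun γ : X ≃ᵢ X => (γ : X → X)) '' (Γ : Set (X ≃ᵢ X)) :=
      ⟨1, Γ.one_mem, rfl⟩
    have hd := hΓ.to_subtype
    have hn : {(⟨_, hmem⟩ : ((fun γ : X ≃ᵢ X => (γ : X → X)) '' (Γ : Set (X ≃ᵢ X)) : Set _))} ∈
        𝓝 (⟨_, hmem⟩ : ((fun γ : X ≃ᵢ X => (γ : X → X)) '' (Γ : Set (X ≃ᵢ X)) : Set _)) := by
      rw [nhds_discrete]; exact mem_pure.2 rfl
    obtain ⟨U, hU, hUs⟩ := mem_nhds_subtype _ _ _ |>.1 hn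
    rw [nhds_pi, Filter.mem_pi] at hU
    obtain ⟨I, hI, t, ht, htU⟩ := hU
    choose r hr hrt using fun x => Metric.mem_nhds_iff.1 (ht x)
    obtain ⟨ε, hε, hεr⟩ : ∃ ε > 0, ∀ x ∈ I, ε ≤ r x := by
      rcases I.eq_empty_or_nonempty with rfl | hne
      · exact ⟨1, one_pos, by simp⟩
      · obtain ⟨a, _, ha⟩ := I.exists_min_image r hI hne
        exact ⟨r a, hr a, ha⟩
    refine ⟨hI.toFinset, ε, hε, fun γ hγ h => ?_⟩
    have h₁ : (γ : X → X) ∈ U := htU fun x hx =>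
      hrt x (Metric.mem_ball.2 ((h x (hI.mem_toFinset.2 hx)).trans_le (hεr x hx)))
    have h₂ := @hUs ⟨γ, γ, hγ, rfl⟩ h₁
    ext x
    exact congrFun (congrArg Subtype.val h₂) x
  have hK : TotallyBounded (Set.pi univ fun x : F => Metric.closedBall o (R + dist (x : X) o)) :=
    (isCompact_univ_pi fun _ => isCompact_closedBall _ _).totallyBounded
  obtain ⟨t, ht, hcov⟩ := Metric.totallyBounded_iff.1 hK (ε / 2) (half_pos hε)
  have hex : ∀ γ : X ≃ᵢ X, γ ∈ Γ ∧ dist (γ o) o ≤ R →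
      ∃ y ∈ t, dist (fun x : F => γ x) y < ε / 2 := by
    rintro γ ⟨-, hγ⟩
    have : (fun x : F => γ x) ∈ Set.pi univ fun x : F => Metric.closedBall o (R + dist (x : X) o) := by
      intro x _
      have := dist_triangle (γ x) (γ o) o
      rw [γ.isometry.dist_eq] at this
      rw [Metric.mem_closedBall]
      linarith
    simpa using hcov this
  have : Nonempty (F → X) := ⟨fun x => x⟩
  choose! y hyt hy using hex
  refine Set.Finite.of_injOn (f := y) (fun γ hγ => hyt γ hγ) ?_ ht
  intro γ hγ γ' hγ' h
  have : γ⁻¹ * γ' = 1 := by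
    refine hF _ (Γ.mul_mem (Γ.inv_mem hγ.1) hγ'.1) fun x hx => ?_
    rw [IsometryEquiv.mul_apply, dist_isometryEquiv_apply, inv_inv]
    have h₁ := dist_triangle_right (fun x : F => γ' x) (fun x : F => γ x) (y γ)
    have h₂ := hy γ hγ
    have h₃ := hy γ' hγ'
    rw [← h] at h₃
    exact (dist_le_pi_dist (fun x : F => γ' x) (fun x : F => γ x) ⟨x, hx⟩).trans_lt (by linarith)
  exact (inv_mul_eq_one.1 this)

/-! ### Counting with polynomial loss -/

section Counting

variable {X : Type*} [MetricSpace X] {o : X}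

/-- Passing to shortest representatives of the cosets of a cyclic group whose orbit grows
linearly costs only a linear factor. -/
theorem card_le_card_shortest_mul {Γ : Subgroup (X ≃ᵢ X)} {g : X ≃ᵢ X} (hgΓ : g ∈ Γ)
    (hg : ∀ j : ℤ, |(j : ℝ)| ≤ dist ((g ^ j) o) o) {n : ℕ} {A M : Finset (X ≃ᵢ X)}
    (hA : ∀ γ, γ ∈ A ↔ γ ∈ Γ ∧ dist (γ o) o ≤ n)
    (hM : ∀ γ, γ ∈ M ↔ γ ∈ A ∧ ∀ j : ℤ, dist (γ o) o ≤ dist ((γ * g ^ j) o) o) :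
    A.card ≤ M.card * (4 * n + 1) := by
  have hlow : ∀ γ ∈ A, ∀ j : ℤ, |(j : ℝ)| ≤ dist ((γ * g ^ j) o) o + n := by
    intro γ hγ j
    have h₁ := dist_triangle (γ ((g ^ j) o)) o (γ o)
    rw [γ.isometry.dist_eq, dist_comm o (γ o)] at h₁
    have h₂ := ((hA γ).1 hγ).2
    have h₃ := hg j
    rw [IsometryEquiv.mul_apply]
    linarith
  have hex : ∀ γ ∈ A, ∃ j ∈ Finset.Icc (-(2 * n : ℤ)) (2 * n), γ * g ^ j ∈ M := by
    intro γ hγ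
    -- For |j| > 2n the element γgʲ is longer than n, so the minimum over this window of 4n + 1
    -- exponents is global.
    obtain ⟨j, hj, hmin⟩ := (Finset.Icc (-(2 * n : ℤ)) (2 * n)).exists_min_image
      (fun j => dist ((γ * g ^ j) o) o) ⟨0, by simp⟩
    have hγA := (hA γ).1 hγ
    have h0 : dist ((γ * g ^ j) o) o ≤ dist (γ o) o := by simpa using hmin 0 (by simp)
    have hall : ∀ i : ℤ, dist ((γ * g ^ j) o) o ≤ dist ((γ * g ^ i) o) o := by
      intro i
      by_cases hi : i ∈ Finset.Icc (-(2 * n : ℤ)) (2 * n)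
      · exact hmin i hi
      · have h₁ : (2 * n : ℝ) < |(i : ℝ)| := by
          rw [Finset.mem_Icc, ← abs_le, not_le] at hi
          exact_mod_cast hi
        have h₂ := hlow γ hγ i
        linarith [hγA.2]
    refine ⟨j, hj, (hM _).2 ⟨(hA _).2 ⟨Γ.mul_mem hγA.1 (Γ.zpow_mem hgΓ j), h0.trans hγA.2⟩, ?_⟩⟩
    intro i
    rw [mul_assoc, ← zpow_add]
    exact hall _
  choose! j hj hjM using hex
  have := Finset.card_le_card_of_injOn (s := A) (t := M ×ˢ Finset.Icc (-(2 * n : ℤ)) (2 * n))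
    (fun γ => (γ * g ^ j γ, j γ)) (fun γ hγ => Finset.mem_product.2 ⟨hjM γ hγ, hj γ hγ⟩) (by
      intro γ _ γ' _ h
      simp only [Prod.mk.injEq] at h
      rw [h.2] at h
      exact mul_right_cancel h.1)
  rw [Finset.card_product, Int.card_Icc] at this
  convert this using 2
  omega

/-- A maximal separated subset is R-dense in A, and each of its elements accounts for at most |B|
elements of A. -/
theorem exists_separated_subset {Γ : Subgroup (X ≃ᵢ X)} {R : ℝ} (hR : 0 ≤ R)
    {B : Finset (X ≃ᵢ X)} (hB : ∀ γ, γ ∈ B ↔ γ ∈ Γ ∧ dist (γ o) o ≤ R)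
    {A : Finset (X ≃ᵢ X)} (hA : ∀ γ ∈ A, γ ∈ Γ) :
    ∃ S ⊆ A, (∀ γ ∈ S, ∀ γ' ∈ S, γ ≠ γ' → R < dist (γ o) (γ' o)) ∧
      A.card ≤ S.card * B.card := by
  classical
  obtain ⟨S, hS, hmax⟩ := (A.powerset.filter fun S =>
    ∀ γ ∈ S, ∀ γ' ∈ S, γ ≠ γ' → R < dist (γ o) (γ' o)).exists_max_image Finset.card ⟨∅, by simp⟩
  simp only [Finset.mem_filter, Finset.mem_powerset] at hS hmax
  refine ⟨S, hS.1, hS.2, ?_⟩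
  have hex : ∀ a ∈ A, ∃ s ∈ S, dist (a o) (s o) ≤ R := by
    intro a ha
    by_contra! hc
    have haS : a ∉ S := fun h => absurd (hc a h) (by simpa using hR)
    have := hmax (insert a S) ⟨Finset.insert_subset ha hS.1, ?_⟩
    · rw [Finset.card_insert_of_notMem haS] at this
      omega
    · simp only [Finset.mem_insert]
      rintro γ (rfl | hγ) γ' (rfl | hγ') hne
      · exact absurd rfl hne
      · exact hc _ hγ'
      · rw [dist_comm]; exact hc _ hγ
      · exact hS.2 γ hγ γ' hγ' hne
  choose! f hfS hf using hex
  have := Finset.card_le_card_of_injOn (s := A) (t := S ×ˢ B) (fun a => (f a, (f a)⁻¹ * a))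
    (fun a ha => Finset.mem_product.2 ⟨hfS a ha, (hB _).2
      ⟨Γ.mul_mem (Γ.inv_mem (hA _ (hS.1 (hfS a ha)))) (hA a ha), by
        rw [IsometryEquiv.mul_apply, dist_isometryEquiv_apply, inv_inv]
        exact hf a ha⟩⟩) (by
      intro γ _ γ' _ h
      simp only [Prod.mk.injEq] at h
      rw [h.1] at h
      exact mul_left_cancel h.2)
  rwa [Finset.card_product] at this

theorem exists_shell {n : ℕ} {A : Finset (X ≃ᵢ X)} (hA : ∀ γ ∈ A, dist (γ o) o ≤ n) :
    ∃ m : ℕ, m ≤ n ∧ ∃ T ⊆ A, (∀ γ ∈ T, (m : ℝ) ≤ dist (γ o) o ∧ dist (γ o) o ≤ m + 1) ∧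
      A.card ≤ (n + 1) * T.card := by
  have hn : (0 : ℝ) < n + 1 := by positivity
  obtain ⟨m, hm, hcard⟩ := Finset.exists_le_card_fiber_of_nsmul_le_card_of_maps_to
    (s := A) (t := Finset.range (n + 1)) (f := fun γ => ⌊dist (γ o) o⌋₊)
    (b := (A.card : ℝ) / (n + 1))
    (fun γ hγ => Finset.mem_range.2 (Nat.lt_succ_of_le (Nat.floor_le_of_le (hA γ hγ))))
    ⟨0, by simp⟩ (by
      rw [Finset.card_range, nsmul_eq_mul]
      push_cast
      rw [mul_div_cancel₀ _ hn.ne'])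
  refine ⟨m, by simpa [Nat.lt_succ_iff] using hm, {γ ∈ A | ⌊dist (γ o) o⌋₊ = m},
    Finset.filter_subset _ _, fun γ hγ => ?_, ?_⟩
  · have h := (Finset.mem_filter.1 hγ).2
    rw [Nat.floor_eq_iff dist_nonneg] at h
    exact ⟨h.1, h.2.le⟩
  · rw [div_le_iff₀ hn] at hcard
    rw [mul_comm]
    exact_mod_cast hcard

end Counting

/-! ### Lower bounds for exponents from ping-pong -/

section Growth

variable {X : Type*} [MetricSpace X] {o : X}

/-- Ping-pong: maps sending a common domain into disjoint pieces of it have many orbit points. -/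
theorem exists_orbit_points_of_pingPong {ι : Type*} {S : Finset ι} {f : ι → X ≃ᵢ X}
    {P : ι → Set X} {Y : Set X} {Γ : Subgroup (X ≃ᵢ X)} {ℓ : ℕ} (hoY : o ∈ Y)
    (hmap : ∀ i ∈ S, MapsTo (f i) Y (P i)) (hPY : ∀ i ∈ S, P i ⊆ Y)
    (hP : ∀ i ∈ S, ∀ j ∈ S, i ≠ j → Disjoint (P i) (P j)) (hΓ : ∀ i ∈ S, f i ∈ Γ)
    (hℓ : ∀ i ∈ S, dist (f i o) o ≤ ℓ) (k : ℕ) :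
    ((S.card ^ k : ℕ) : ENat) ≤ (Metric.closedBall o ((k * ℓ : ℕ) : ℝ) ∩
      ((fun γ : X ≃ᵢ X => γ o) '' (Γ : Set (X ≃ᵢ X)))).encard := by
  classical
  -- The induction keeps the points in Y, so that every map can be applied again; disjointness of
  -- the P i makes the new points distinct.
  obtain ⟨W, hW, hcard⟩ : ∃ W : Finset X, (∀ x ∈ W, x ∈ Y ∧ dist x o ≤ (k * ℓ : ℕ) ∧
      ∃ γ ∈ Γ, γ o = x) ∧ W.card = S.card ^ k := by
    induction k with
    | zero => exact ⟨{o}, by simpa using ⟨hoY, 1, Γ.one_mem, rfl⟩, by simp⟩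
    | succ k ih =>
      obtain ⟨W, hW, hcard⟩ := ih
      refine ⟨(S ×ˢ W).image fun p => f p.1 p.2, ?_, ?_⟩
      · intro x hx
        obtain ⟨⟨i, y⟩, hp, rfl⟩ := Finset.mem_image.1 hx
        obtain ⟨hi, hy⟩ := Finset.mem_product.1 hp
        obtain ⟨h₁, h₂, γ, hγ, rfl⟩ := hW y hy
        refine ⟨hPY i hi (hmap i hi h₁), ?_, f i * γ, Γ.mul_mem (hΓ i hi) hγ, rfl⟩
        have h₃ := dist_triangle (f i (γ o)) (f i o) o
        rw [(f i).isometry.dist_eq] at h₃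
        have h₄ := hℓ i hi
        push_cast at h₂ ⊢
        linarith
      · rw [Finset.card_image_of_injOn, Finset.card_product, hcard, pow_succ']
        rintro ⟨i, x⟩ hp ⟨j, y⟩ hq h
        obtain ⟨hi, hx⟩ := Finset.mem_product.1 hp
        obtain ⟨hj, hy⟩ := Finset.mem_product.1 hq
        dsimp only at h hi hx hj hy
        have hij : i = j := by
          by_contra hne
          exact (hP i hi j hj hne).le_bot ⟨hmap i hi (hW x hx).1, h ▸ hmap j hj (hW y hy).1⟩
        subst hij
        rw [(f i).injective h]
  rw [← hcard, ← Set.encard_coe_eq_coe_finsetCard]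
  refine Set.encard_le_encard fun x hx => ?_
  obtain ⟨-, h₂, γ, hγ, rfl⟩ := hW x hx
  exact ⟨h₂, γ, hγ, rfl⟩

theorem le_criticalExponentSet {P : Set X} {N ℓ : ℕ} {r : ℝ} (hℓ : ℓ ≠ 0)
    (hr : Real.exp (r * ℓ) ≤ N)
    (hP : ∀ k : ℕ, ((N ^ k : ℕ) : ENat) ≤ (Metric.closedBall o ((k * ℓ : ℕ) : ℝ) ∩ P).encard) :
    (r : EReal) ≤ criticalExponentSet o P := by
  refine le_limsup_of_frequently_le (frequently_atTop.2 fun a => ⟨(a + 1) * ℓ, ?_, ?_⟩)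
  · nlinarith [Nat.one_le_iff_ne_zero.2 hℓ]
  set n := (a + 1) * ℓ with hn
  have hn0 : (n : ℝ) ≠ 0 := by
    have : n ≠ 0 := mul_ne_zero (Nat.succ_ne_zero a) hℓ
    exact_mod_cast this
  have h₁ : ((r * n : ℝ) : EReal) ≤
      ENNReal.log (((Metric.closedBall o (n : ℝ) ∩ P).encard : ENat) : ENNReal) := by
    rw [← EReal.log_exp ((r * n : ℝ) : EReal), ENNReal.log_le_log_iff, EReal.exp_coe]
    have h₂ : Real.exp (r * n) ≤ ((N ^ (a + 1) : ℕ) : ℝ) := by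
      rw [hn]
      push_cast
      calc Real.exp (r * ((a + 1) * ℓ)) = Real.exp (r * ℓ) ^ (a + 1) := by
            rw [← Real.exp_nat_mul]; push_cast; ring_nf
        _ ≤ _ := by gcongr
    refine (ENNReal.ofReal_le_ofReal h₂).trans ?_
    rw [ENNReal.ofReal_natCast]
    exact_mod_cast ENat.toENNReal_le.2 (hP (a + 1))
  calc (r : EReal) = ((1 / n : ℝ) : EReal) * ((r * n : ℝ) : EReal) := by
        rw [← EReal.coe_mul]; congr 1; field_simp
    _ ≤ _ := mul_le_mul_of_nonneg_left h₁ (by exact_mod_cast by positivity)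

/-- Quantifying over finite bounds N keeps the estimate real-valued; a ball with infinitely many
points satisfies it vacuously. -/
theorem frequently_exp_lt_encard {P : Set X} {s : ℝ} (hs : (s : EReal) < criticalExponentSet o P) :
    ∃ᶠ n : ℕ in atTop, ∀ N : ℕ, (Metric.closedBall o (n : ℝ) ∩ P).encard ≤ N →
      Real.exp (s * n) < N := by
  refine ((frequently_lt_of_lt_limsup (by isBoundedDefault) hs).and_eventually
    (eventually_ge_atTop 1)).mono ?_
  rintro n ⟨h, hn⟩ N hN
  by_contra! hc
  refine absurd h (not_lt.2 ?_)
  have hn0 : (n : ℝ) ≠ 0 := by exact_mod_cast Nat.one_le_iff_ne_zero.1 hn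
  have h₁ : ENNReal.log (((Metric.closedBall o (n : ℝ) ∩ P).encard : ENat) : ENNReal) ≤
      ((s * n : ℝ) : EReal) := by
    rw [← EReal.log_exp ((s * n : ℝ) : EReal), ENNReal.log_le_log_iff, EReal.exp_coe]
    refine (ENat.toENNReal_le.2 hN).trans ?_
    rw [ENat.toENNReal_coe, ← ENNReal.ofReal_natCast]
    exact ENNReal.ofReal_le_ofReal hc
  calc _ ≤ ((1 / n : ℝ) : EReal) * ((s * n : ℝ) : EReal) :=
        mul_le_mul_of_nonneg_left h₁ (by exact_mod_cast by positivity)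
    _ = (s : EReal) := by rw [← EReal.coe_mul]; congr 1; field_simp

end Growth

/-! ### Half-shadows and Schottky groups of conjugates -/

section Schottky

variable {X : Type*} [MetricSpace X] {o : X} {δ : ℝ}

theorem gromovProduct_le_dist_right (o x y : X) : gromovProduct o x y ≤ dist y o := by
  have := dist_triangle x y o
  unfold gromovProduct
  linarith

theorem HyperbolicWith.le_of_le_of_le (h : HyperbolicWith o δ) {x y z : X} {a : ℝ}
    (h₁ : a ≤ gromovProduct o x y) (h₂ : a ≤ gromovProduct o y z) :
    a - δ ≤ gromovProduct o x z :=
  (sub_le_sub_right (le_min h₁ h₂) _).trans (h x y z)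

/-- The points seen from `o` in the direction of `y`, up to half the distance of `y`. -/
def halfShadow (o y : X) : Set X := {x | dist y o / 2 ≤ gromovProduct o x y}

theorem isClosed_halfShadow (o y : X) : IsClosed (halfShadow o y) :=
  isClosed_le continuous_const (continuous_gromovProduct_left o y)

/-- Since (hx|ho) + (x|h⁻¹o) = |h|, one of the two products is at least |h|/2; hence the threshold
one half. -/
theorem mapsTo_compl_halfShadow (o : X) (h : X ≃ᵢ X) :
    MapsTo h (halfShadow o (h⁻¹ o))ᶜ (halfShadow o (h o)) := by
  intro x hx
  simp only [halfShadow, mem_compl_iff, mem_ofPred_eq, not_le, dist_inv_apply_self] at hx ⊢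
  rw [gromovProduct_map_base]
  linarith

theorem HyperbolicWith.gromovProduct_le_of_mem_halfShadow (hδ : HyperbolicWith o δ)
    (h0 : 0 ≤ δ) {x y z : X} {D : ℝ} (hD : D + 2 * δ < dist y o / 2)
    (hyz : gromovProduct o y z ≤ D) (hx : x ∈ halfShadow o y) :
    gromovProduct o x z ≤ D + δ := by
  have hx : dist y o / 2 ≤ gromovProduct o x y := hx
  rw [gromovProduct_comm] at hx
  have := hδ.le_of_lt (x := y) (y := x) (z := z) (by linarith)
  linarith

theorem HyperbolicWith.le_gromovProduct_translate_halfShadow (hδ : HyperbolicWith o δ)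
    (h0 : 0 ≤ δ) {x y : X} {γ : X ≃ᵢ X} {D : ℝ} (hD : D + 2 * δ < dist y o / 2)
    (hy : gromovProduct o y (γ⁻¹ o) ≤ D) (hx : x ∈ halfShadow o y) :
    dist (γ o) o - D - δ ≤ gromovProduct o (γ x) (γ o) := by
  have := hδ.gromovProduct_le_of_mem_halfShadow h0 hD hy hx
  rw [gromovProduct_map_base]
  linarith

/-- Half-shadows of points in different directions, moved by elements whose orbit points are
far apart but at comparable distance from the base point. -/
theorem HyperbolicWith.gromovProduct_translates_lt (hδ : HyperbolicWith o δ) (h0 : 0 ≤ δ)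
    {γ γ' : X ≃ᵢ X} {m D : ℝ} (hγ : m ≤ dist (γ o) o ∧ dist (γ o) o ≤ m + 1)
    (hγ' : m ≤ dist (γ' o) o ∧ dist (γ' o) o ≤ m + 1)
    (hsep : 2 * (D + 3 * δ + 1) < dist (γ o) (γ' o)) {y y' x x' : X}
    (hD : D + 2 * δ < dist y o / 2) (hD' : D + 2 * δ < dist y' o / 2)
    (hy : gromovProduct o y (γ⁻¹ o) ≤ D) (hy' : gromovProduct o y' (γ'⁻¹ o) ≤ D)
    (hx : x ∈ halfShadow o y) (hx' : x' ∈ halfShadow o y') :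
    gromovProduct o (γ x) (γ' x') < m - D - δ := by
  by_contra! hc
  have h₁ := hδ.le_gromovProduct_translate_halfShadow h0 hD hy hx
  have h₂ := hδ.le_gromovProduct_translate_halfShadow h0 hD' hy' hx'
  rw [gromovProduct_comm] at h₁
  -- The chain γo, γx, γ'x', γ'o gives (γo|γ'o) ≥ m - D - 3δ; as both lengths are at most m + 1,
  -- this contradicts `hsep`.
  have h₃ := hδ.le_of_le_of_le (a := m - D - δ) (by linarith) hc
  have h₄ := hδ.le_of_le_of_le (a := m - D - δ - δ) h₃ (by linarith)
  unfold gromovProduct at h₄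
  linarith [hγ.2, hγ'.2]

theorem HyperbolicWith.disjoint_translates_halfShadow (hδ : HyperbolicWith o δ) (h0 : 0 ≤ δ)
    {γ γ' : X ≃ᵢ X} {m D : ℝ} (hγ : m ≤ dist (γ o) o ∧ dist (γ o) o ≤ m + 1)
    (hγ' : m ≤ dist (γ' o) o ∧ dist (γ' o) o ≤ m + 1)
    (hsep : 2 * (D + 3 * δ + 1) < dist (γ o) (γ' o)) {y y' : X}
    (hD : D + 2 * δ < dist y o / 2) (hD' : D + 2 * δ < dist y' o / 2)
    (hy : gromovProduct o y (γ⁻¹ o) ≤ D) (hy' : gromovProduct o y' (γ'⁻¹ o) ≤ D) :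
    Disjoint (γ '' halfShadow o y) (γ' '' halfShadow o y') := by
  rw [Set.disjoint_left]
  rintro _ ⟨x, hx, rfl⟩ ⟨x', hx', h⟩
  have h₁ := hδ.gromovProduct_translates_lt h0 hγ hγ' hsep hD hD' hy hy' hx hx'
  have h₂ := hδ.le_gromovProduct_translate_halfShadow h0 hD hy hx
  -- For a common point, the product of the two points is its distance to o, which is at least m - D
  -- - δ.
  rw [h, gromovProduct_self] at h₁
  rw [gromovProduct_comm] at h₂
  linarith [gromovProduct_le_dist_right o (γ o) (γ x), hγ.1]

theorem HyperbolicWith.gromovProduct_halfShadows_le (hδ : HyperbolicWith o δ) (h0 : 0 ≤ δ)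
    {x x' y y' : X} {D : ℝ} (hD : D + 2 * δ < dist y o / 2) (hD' : D + 2 * δ < dist y' o / 2)
    (hyy' : gromovProduct o y y' ≤ D) (hx : x ∈ halfShadow o y) (hx' : x' ∈ halfShadow o y') :
    gromovProduct o x x' ≤ D + 2 * δ := by
  have h₁ := hδ.gromovProduct_le_of_mem_halfShadow h0 hD hyy' hx
  have hx' : dist y' o / 2 ≤ gromovProduct o x' y' := hx'
  rw [gromovProduct_comm] at h₁ hx' ⊢
  by_contra! hc
  have := hδ y' x' x
  have := lt_min (hD'.trans_le hx') hc
  linarith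

theorem HyperbolicWith.disjoint_halfShadow (hδ : HyperbolicWith o δ) (h0 : 0 ≤ δ)
    {y y' : X} {D : ℝ} (hD : D + 2 * δ < dist y o / 2) (hD' : D + 2 * δ < dist y' o / 2)
    (hyy' : gromovProduct o y y' ≤ D) : Disjoint (halfShadow o y) (halfShadow o y') := by
  rw [Set.disjoint_left]
  intro x hx hx'
  have h₁ := hδ.gromovProduct_le_of_mem_halfShadow h0 hD hyy' hx
  have hx' : dist y' o / 2 ≤ gromovProduct o x y' := hx'
  linarith

theorem GromovDisjoint.symm {A B : Set X} (h : GromovDisjoint o A B) : GromovDisjoint o B A := by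
  obtain ⟨h₁, C, hC, h₂⟩ := h
  exact ⟨h₁.symm, C, hC, fun a ha b hb => gromovProduct_comm o a b ▸ h₂ b hb a ha⟩

theorem GromovDisjoint.of_isClosed {A B : Set X} (hA : IsClosed A) (hB : IsClosed B)
    (h : Disjoint A B) {C : ℝ} (hC : ∀ a ∈ A, ∀ b ∈ B, gromovProduct o a b ≤ C) :
    GromovDisjoint o A B := by
  refine ⟨by rwa [hA.closure_eq, hB.closure_eq], max C 1, lt_max_of_lt_right one_pos, ?_⟩
  exact fun a ha b hb => (hC a ha b hb).trans (le_max_left _ _)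

theorem conj_mapsTo (o : X) (γ h : X ≃ᵢ X) :
    MapsTo (γ * h * γ⁻¹) (γ '' halfShadow o (h⁻¹ o))ᶜ (γ '' halfShadow o (h o)) := by
  intro x hx
  refine ⟨h (γ⁻¹ x), mapsTo_compl_halfShadow o h fun hc => hx ⟨_, hc, ?_⟩, rfl⟩
  exact IsometryEquiv.apply_inv_self γ x

theorem notMem_translate_halfShadow {γ : X ≃ᵢ X} {y : X} {D : ℝ} (hD : D < dist y o / 2)
    (hy : gromovProduct o y (γ⁻¹ o) ≤ D) : o ∉ γ '' halfShadow o y := by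
  rintro ⟨x, hx, hxo⟩
  have hx : dist y o / 2 ≤ gromovProduct o x y := hx
  rw [← hxo, IsometryEquiv.inv_apply_self, hxo] at hy
  rw [gromovProduct_comm] at hx
  linarith

theorem isClosed_translate_halfShadow (γ : X ≃ᵢ X) (o y : X) :
    IsClosed (γ '' halfShadow o y) :=
  γ.toHomeomorph.isClosed_image.2 (isClosed_halfShadow o y)

/-- Conjugates of one long element by many elements whose orbit points lie at comparable distance
from the base point, far from each other. -/
structure ConjugateFamily (o : X) (δ D m : ℝ) (h : X ≃ᵢ X) (S : Finset (X ≃ᵢ X)) : Prop where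
  long : D + 2 * δ < dist (h o) o / 2
  spread : gromovProduct o (h o) (h⁻¹ o) ≤ D
  shell : ∀ γ ∈ S, m ≤ dist (γ o) o ∧ dist (γ o) o ≤ m + 1
  transverse : ∀ γ ∈ S, gromovProduct o (h o) (γ⁻¹ o) ≤ D ∧ gromovProduct o (h⁻¹ o) (γ⁻¹ o) ≤ D
  separated : ∀ γ ∈ S, ∀ γ' ∈ S, γ ≠ γ' → 2 * (D + 3 * δ + 1) < dist (γ o) (γ' o)

variable {D m : ℝ} {h : X ≃ᵢ X} {S : Finset (X ≃ᵢ X)}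

theorem ConjugateFamily.long_inv (hS : ConjugateFamily o δ D m h S) :
    D + 2 * δ < dist (h⁻¹ o) o / 2 := by
  rw [dist_inv_apply_self]; exact hS.long

theorem ConjugateFamily.isSchottkyGenerating (hδ : HyperbolicWith o δ) (h0 : 0 ≤ δ)
    (hS : ConjugateFamily o δ D m h S) :
    IsSchottkyGenerating o ((fun γ => γ * h * γ⁻¹) '' (S : Set (X ≃ᵢ X))) := by
  have hlt := hS.long
  have hlt' := hS.long_inv
  have hfin : ((fun γ => γ * h * γ⁻¹) '' (S : Set (X ≃ᵢ X))).Finite := S.finite_toSet.image _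
  refine ⟨hfin, ?_⟩
  choose c hcS hc using fun g : (fun γ => γ * h * γ⁻¹) '' (S : Set (X ≃ᵢ X)) => g.2
  have hcinj : ∀ i j, c i = c j → i = j := fun i j hij =>
    Subtype.ext (by rw [← hc i, ← hc j, hij])
  have hne : ∀ i j, i ≠ j → ∀ y, (y = h o ∨ y = h⁻¹ o) → ∀ y', (y' = h o ∨ y' = h⁻¹ o) →
      GromovDisjoint o (c i '' halfShadow o y) (c j '' halfShadow o y') := by
    intro i j hij y hy y' hy'
    have hsep := hS.separated _ (hcS i) _ (hcS j) fun hc => hij (hcinj i j hc)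
    have hl : D + 2 * δ < dist y o / 2 := by rcases hy with rfl | rfl <;> assumption
    have hl' : D + 2 * δ < dist y' o / 2 := by rcases hy' with rfl | rfl <;> assumption
    have ht : gromovProduct o y ((c i)⁻¹ o) ≤ D := by
      rcases hy with rfl | rfl
      exacts [(hS.transverse _ (hcS i)).1, (hS.transverse _ (hcS i)).2]
    have ht' : gromovProduct o y' ((c j)⁻¹ o) ≤ D := by
      rcases hy' with rfl | rfl
      exacts [(hS.transverse _ (hcS j)).1, (hS.transverse _ (hcS j)).2]
    refine GromovDisjoint.of_isClosed (isClosed_translate_halfShadow _ _ _)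
      (isClosed_translate_halfShadow _ _ _) (hδ.disjoint_translates_halfShadow h0
        (hS.shell _ (hcS i)) (hS.shell _ (hcS j)) hsep hl hl' ht ht') (C := m - D - δ) ?_
    rintro _ ⟨x, hx, rfl⟩ _ ⟨x', hx', rfl⟩
    exact (hδ.gromovProduct_translates_lt h0 (hS.shell _ (hcS i)) (hS.shell _ (hcS j)) hsep
      hl hl' ht ht' hx hx').le
  have heq : ∀ i, GromovDisjoint o (c i '' halfShadow o (h o)) (c i '' halfShadow o (h⁻¹ o)) := by
    intro i
    refine GromovDisjoint.of_isClosed (isClosed_translate_halfShadow _ _ _)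
      (isClosed_translate_halfShadow _ _ _)
      (disjoint_image_of_injective (c i).injective
        (hδ.disjoint_halfShadow h0 hlt hlt' hS.spread))
      (C := D + 2 * δ + dist (c i o) o) ?_
    rintro _ ⟨x, hx, rfl⟩ _ ⟨x', hx', rfl⟩
    refine (gromovProduct_map_le o (c i) x x').trans ?_
    linarith [hδ.gromovProduct_halfShadows_le h0 hlt hlt' hS.spread hx hx']
  refine ⟨fun i => c i '' halfShadow o (h o), fun i => c i '' halfShadow o (h⁻¹ o), ?_, ?_, o, ?_⟩
  · rintro (i | i) (j | j) hij
    · exact hne i j (fun hc => hij (hc ▸ rfl)) _ (.inl rfl) _ (.inl rfl)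
    · by_cases hc : i = j
      · subst hc; exact heq i
      · exact hne i j hc _ (.inl rfl) _ (.inr rfl)
    · by_cases hc : i = j
      · subst hc; exact (heq i).symm
      · exact hne i j hc _ (.inr rfl) _ (.inl rfl)
    · exact hne i j (fun hc => hij (hc ▸ rfl)) _ (.inr rfl) _ (.inr rfl)
  · intro g
    have := (conj_mapsTo o (c g) h).image_subset
    have hg : c g * h * (c g)⁻¹ = g := hc g
    rwa [hg] at this
  · have := hfin.to_subtype
    rw [IsOpen.interior_eq]
    · simp only [mem_compl_iff, mem_iUnion, mem_union, not_exists, not_or]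
      exact fun i => ⟨notMem_translate_halfShadow (by linarith) (hS.transverse _ (hcS i)).1,
        notMem_translate_halfShadow (by linarith) (hS.transverse _ (hcS i)).2⟩
    · exact (isClosed_iUnion_of_finite fun i => (isClosed_translate_halfShadow _ _ _).union
        (isClosed_translate_halfShadow _ _ _)).isOpen_compl

theorem ConjugateFamily.le_criticalExponent (hδ : HyperbolicWith o δ) (h0 : 0 ≤ δ)
    (hS : ConjugateFamily o δ D m h S) {ℓ : ℕ} (hℓ : ℓ ≠ 0)
    (hlen : 2 * (m + 1) + dist (h o) o ≤ ℓ) {r : ℝ} (hr : Real.exp (r * ℓ) ≤ S.card) :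
    (r : EReal) ≤ criticalExponent o
      (Subgroup.closure ((fun γ => γ * h * γ⁻¹) '' (S : Set (X ≃ᵢ X))) : Set (X ≃ᵢ X)) := by
  have hlt := hS.long
  have hlt' := hS.long_inv
  -- Only positive words are counted: Y omits just the repelling pieces, so it contains every
  -- attracting one.
  refine le_criticalExponentSet hℓ hr fun k => exists_orbit_points_of_pingPong (S := S)
    (f := fun γ : X ≃ᵢ X => γ * h * γ⁻¹) (P := fun γ : X ≃ᵢ X => γ '' halfShadow o (h o))
    (Y := {x | ∀ γ ∈ S, x ∉ γ '' halfShadow o (h⁻¹ o)}) ?_ ?_ ?_ ?_ ?_ ?_ k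
  · exact fun γ hγ => notMem_translate_halfShadow (by linarith) (hS.transverse γ hγ).2
  · exact fun γ hγ x hx => conj_mapsTo o γ h (hx γ hγ)
  · intro γ hγ x hx γ' hγ' hx'
    by_cases hc : γ = γ'
    · subst hc
      exact (disjoint_image_of_injective γ.injective
        (hδ.disjoint_halfShadow h0 hlt hlt' hS.spread)).le_bot ⟨hx, hx'⟩
    · exact (hδ.disjoint_translates_halfShadow h0 (hS.shell γ hγ) (hS.shell γ' hγ')
        (hS.separated γ hγ γ' hγ' hc) hlt hlt' (hS.transverse γ hγ).1
        (hS.transverse γ' hγ').2).le_bot ⟨hx, hx'⟩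
  · exact fun γ hγ γ' hγ' hc => hδ.disjoint_translates_halfShadow h0 (hS.shell γ hγ)
      (hS.shell γ' hγ') (hS.separated γ hγ γ' hγ' hc) hlt hlt (hS.transverse γ hγ).1
      (hS.transverse γ' hγ').1
  · exact fun γ hγ => Subgroup.subset_closure ⟨γ, hγ, rfl⟩
  · intro γ hγ
    have h₁ := dist_triangle (γ (h (γ⁻¹ o))) (γ o) o
    have h₂ := dist_triangle (h (γ⁻¹ o)) (h o) o
    rw [γ.isometry.dist_eq] at h₁
    rw [h.isometry.dist_eq, dist_inv_apply_self] at h₂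
    change dist (γ (h (γ⁻¹ o))) o ≤ ℓ
    linarith [(hS.shell γ hγ).2]

end Schottky

/-! ### Assembling the estimate -/

theorem isSchottkyGroup_bot {X : Type*} [MetricSpace X] (o : X) :
    IsSchottkyGroup o (⊥ : Subgroup (X ≃ᵢ X)) := by
  refine ⟨∅, ⟨finite_empty, fun _ => ∅, fun _ => ∅, ?_, ?_, ?_⟩, Subgroup.closure_empty.symm⟩
  · rintro (⟨_, h⟩ | ⟨_, h⟩) <;> exact h.elim
  · rintro ⟨_, h⟩; exact h.elim
  · exact ⟨o, by simp⟩

theorem criticalExponent_nonneg {X : Type*} [MetricSpace X] (o : X) (Γ : Subgroup (X ≃ᵢ X)) :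
    0 ≤ criticalExponent o (Γ : Set (X ≃ᵢ X)) := by
  refine le_criticalExponentSet (N := 1) (ℓ := 1) (r := 0) one_ne_zero (by simp) fun k => ?_
  rw [one_pow, Nat.cast_one, Set.one_le_encard_iff_nonempty]
  exact ⟨o, by simp, 1, Γ.one_mem, rfl⟩

theorem eventually_mul_sq_le_exp (c : ℝ) {a : ℝ} (ha : 0 < a) :
    ∀ᶠ n : ℕ in atTop, c * (n : ℝ) ^ 2 ≤ Real.exp (a * n) := by
  have hc : 0 < |c| + 1 := by positivity
  have h := (isLittleO_pow_exp_pos_mul_atTop 2 ha).bound (inv_pos.2 hc)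
  filter_upwards [tendsto_natCast_atTop_atTop.eventually h] with n hn
  rw [Real.norm_of_nonneg (by positivity), Real.norm_of_nonneg (by positivity),
    inv_mul_eq_div, le_div_iff₀ hc] at hn
  refine le_trans ?_ hn
  rw [mul_comm]
  gcongr
  linarith [le_abs_self c]

theorem unbounded_orbit_of_pos_lt_criticalExponent {X : Type*} [MetricSpace X] [ProperSpace X]
    {o : X} {Γ : Subgroup (X ≃ᵢ X)} (hdisc : IsDiscreteIsometryGroup Γ) {s : ℝ} (hs0 : 0 < s)
    (hs : (s : EReal) < criticalExponent o (Γ : Set (X ≃ᵢ X))) (R : ℝ) :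
    ∃ g ∈ Γ, R ≤ dist (g o) o := by
  by_contra! hR
  set B := (finite_orbit_ball hdisc o R).toFinset with hB
  have h₁ : ∀ᶠ n : ℕ in atTop, (B.card : ℝ) ≤ Real.exp (s * n) := by
    filter_upwards [eventually_mul_sq_le_exp B.card hs0, eventually_ge_atTop 1] with n hn hn1
    refine le_trans ?_ hn
    have : (1 : ℝ) ≤ n := by exact_mod_cast hn1
    exact le_mul_of_one_le_right (by positivity) (one_le_pow₀ this)
  obtain ⟨n, hn, hn'⟩ := ((frequently_exp_lt_encard hs).and_eventually h₁).exists
  refine absurd (hn B.card ?_) (not_lt.2 hn')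
  rw [← Set.encard_coe_eq_coe_finsetCard]
  refine (Set.encard_le_encard ?_).trans (Set.encard_image_le (fun γ : X ≃ᵢ X => γ o) _)
  rintro _ ⟨-, γ, hγ, rfl⟩
  exact ⟨γ, by simpa [hB] using ⟨hγ, (hR γ hγ).le⟩, rfl⟩

/-- In a group without global fixed point at infinity, some element is hyperbolic. -/
theorem HyperbolicWith.exists_hyperbolic {X : Type*} [MetricSpace X] {o : X} {δ : ℝ}
    (hδ : HyperbolicWith o δ) (h0 : 0 ≤ δ) (ho : IsGromovHyperbolic o) {Γ : Subgroup (X ≃ᵢ X)}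
    (hunb : ∀ R : ℝ, ∃ g ∈ Γ, R ≤ dist (g o) o) (hfix : ¬ FixesBoundaryPoint ho Γ) :
    ∃ g ∈ Γ, gromovProduct o (g o) (g⁻¹ o) < dist (g o) o / 2 - (2 * δ + 1) := by
  by_contra! hc
  exact hfix (fixesBoundaryPoint_of_le_gromovProduct ho (fun g hg h hh =>
    hδ.le_gromovProduct_orbit h0 (by positivity) hc hg hh) hunb)

/-- The Schottky subgroups of a discrete group containing a hyperbolic element have exponents at
least half of every number below the exponent of the group. -/
theorem HyperbolicWith.exists_schottky {X : Type*} [MetricSpace X] [ProperSpace X] {o : X} {δ : ℝ}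
    (hδ : HyperbolicWith o δ) (h0 : 0 ≤ δ) {Γ : Subgroup (X ≃ᵢ X)}
    (hdisc : IsDiscreteIsometryGroup Γ) {g : X ≃ᵢ X} (hgΓ : g ∈ Γ)
    (hg : gromovProduct o (g o) (g⁻¹ o) < dist (g o) o / 2 - (2 * δ + 1)) {r s : ℝ}
    (hrs : 2 * r < s) (hs : (s : EReal) < criticalExponent o (Γ : Set (X ≃ᵢ X))) :
    ∃ Γ' ≤ Γ, IsSchottkyGroup o Γ' ∧ (r : EReal) ≤ criticalExponent o (Γ' : Set (X ≃ᵢ X)) := by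
  classical
  obtain ⟨hgj, D, hD⟩ := hδ.exists_separating_power h0 hg
  have hD0 : 0 ≤ D := (gromovProduct_nonneg _ _ _).trans (hD 1 one_ne_zero).1
  obtain ⟨k, hk⟩ := exists_nat_gt (2 * (D + 2 * δ))
  have hk0 : k ≠ 0 := by
    rintro rfl
    rw [Nat.cast_zero] at hk
    linarith
  obtain ⟨hspread, htrans⟩ := hD k hk0
  set h := g ^ k with hh
  have hhΓ : h ∈ Γ := Γ.pow_mem hgΓ k
  have hlong : D + 2 * δ < dist (h o) o / 2 := by
    have := hgj k
    rw [zpow_natCast, Int.cast_natCast, Nat.abs_cast] at this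
    linarith
  set R := 2 * (D + 3 * δ + 1) with hR
  set B := (finite_orbit_ball hdisc o R).toFinset with hBdef
  have hB : ∀ γ, γ ∈ B ↔ γ ∈ Γ ∧ dist (γ o) o ≤ R := by simp [hBdef]
  have hBpos : (0 : ℝ) < B.card := by
    have : 1 ∈ B := (hB 1).2 ⟨Γ.one_mem, by
      rw [IsometryEquiv.coe_one, id, dist_self]; positivity⟩
    exact_mod_cast Finset.card_pos.2 ⟨1, this⟩
  -- Chosen so that 2(m + 1) + |h| ≤ 2n + K whenever m ≤ n.
  set K := 2 + ⌈dist (h o) o⌉₊ with hK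
  -- The gap s - 2r absorbs all losses: |B| from separation, exp(rK), and (n + 1)(4n + 1) ≤ 10n²
  -- from shells and cosets.
  have hev := eventually_mul_sq_le_exp (10 * B.card * Real.exp (r * K)) (sub_pos.2 hrs)
  obtain ⟨n, hn, hn', hn1⟩ := ((frequently_exp_lt_encard hs).and_eventually
    (hev.and (eventually_ge_atTop 1))).exists
  set A := (finite_orbit_ball hdisc o n).toFinset with hAdef
  have hA : ∀ γ, γ ∈ A ↔ γ ∈ Γ ∧ dist (γ o) o ≤ n := by simp [hAdef]
  have hAcard : Real.exp (s * n) < A.card := by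
    refine hn A.card ?_
    rw [← Set.encard_coe_eq_coe_finsetCard]
    refine (Set.encard_le_encard ?_).trans (Set.encard_image_le (fun γ : X ≃ᵢ X => γ o) _)
    rintro _ ⟨hb, γ, hγ, rfl⟩
    exact ⟨γ, (hA γ).2 ⟨hγ, hb⟩, rfl⟩
  set M := A.filter fun γ => ∀ j : ℤ, dist (γ o) o ≤ dist ((γ * g ^ j) o) o with hMdef
  have hM : ∀ γ, γ ∈ M ↔ γ ∈ A ∧ ∀ j : ℤ, dist (γ o) o ≤ dist ((γ * g ^ j) o) o :=
    fun γ => Finset.mem_filter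
  have hAM := card_le_card_shortest_mul hgΓ hgj hA hM
  obtain ⟨m, hmn, T, hTM, hT, hMT⟩ := exists_shell fun γ (hγ : γ ∈ M) =>
    ((hA γ).1 ((hM γ).1 hγ).1).2
  obtain ⟨S, hST, hSsep, hTS⟩ := exists_separated_subset (o := o) (by positivity : 0 ≤ R) hB
    fun γ (hγ : γ ∈ T) => ((hA γ).1 ((hM γ).1 (hTM hγ)).1).1
  have hS : ConjugateFamily o δ D m h S := by
    refine ⟨hlong, hspread, fun γ hγ => hT γ (hST hγ), fun γ hγ => htrans _ fun j => ?_, hSsep⟩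
    -- That γ is shortest in γ⟨g⟩ says that γ⁻¹o is at least as close to o as to every gʲo.
    have := ((hM γ).1 (hTM (hST hγ))).2 j
    rwa [IsometryEquiv.mul_apply, dist_isometryEquiv_apply γ ((g ^ j) o), dist_comm _ (γ⁻¹ o),
      ← dist_inv_apply_self] at this
  have hcard : Real.exp (r * ((2 * n + K : ℕ) : ℝ)) ≤ S.card := by
    have hn1' : (1 : ℝ) ≤ n := by exact_mod_cast hn1
    have h₁ : (A.card : ℝ) ≤ S.card * (B.card * ((n + 1) * (4 * n + 1))) := by
      have : A.card ≤ S.card * (B.card * ((n + 1) * (4 * n + 1))) :=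
        calc A.card ≤ M.card * (4 * n + 1) := hAM
          _ ≤ ((n + 1) * (S.card * B.card)) * (4 * n + 1) := by gcongr; exact hMT.trans (by gcongr)
          _ = _ := by ring
      exact_mod_cast this
    have h₂ : ((n : ℝ) + 1) * (4 * n + 1) ≤ 10 * n ^ 2 := by nlinarith
    have h₃ : 0 < 10 * (n : ℝ) ^ 2 * B.card := by positivity
    rw [← mul_le_mul_iff_left₀ h₃]
    calc Real.exp (r * ((2 * n + K : ℕ) : ℝ)) * (10 * (n : ℝ) ^ 2 * B.card)
        = (10 * B.card * Real.exp (r * K) * n ^ 2) * Real.exp (2 * r * n) := by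
          push_cast
          rw [mul_add, Real.exp_add, show r * (2 * (n : ℝ)) = 2 * r * n by ring]
          ring
      _ ≤ Real.exp ((s - 2 * r) * n) * Real.exp (2 * r * n) := by gcongr
      _ = Real.exp (s * n) := by rw [← Real.exp_add]; ring_nf
      _ ≤ S.card * (B.card * ((n + 1) * (4 * n + 1))) := hAcard.le.trans h₁
      _ ≤ S.card * (B.card * (10 * n ^ 2)) := by gcongr
      _ = _ := by ring
  refine ⟨_, ?_, ⟨_, hS.isSchottkyGenerating hδ h0, rfl⟩,
    hS.le_criticalExponent hδ h0 (ℓ := 2 * n + K) (by omega) ?_ hcard⟩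
  · rw [Subgroup.closure_le]
    rintro _ ⟨γ, hγ, rfl⟩
    have hγΓ := ((hA γ).1 ((hM γ).1 (hTM (hST hγ))).1).1
    exact Γ.mul_mem (Γ.mul_mem hγΓ hhΓ) (Γ.inv_mem hγΓ)
  · have h₁ : (m : ℝ) ≤ n := by exact_mod_cast hmn
    have h₂ := Nat.le_ceil (dist (h o) o)
    rw [hK]
    push_cast
    linarith

theorem mainTheorem5 {X : Type*} [MetricSpace X] [ProperSpace X] (o : X)
    (ho : IsGromovHyperbolic o) (Γ : Subgroup (X ≃ᵢ X))
    (hdisc : IsDiscreteIsometryGroup Γ) (htf : IsTorsionFreeSubgroup Γ)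
    (hfix : ¬ FixesBoundaryPoint ho Γ) :
    ((1 / 2 : ℝ) : EReal) * criticalExponent o (Γ : Set (X ≃ᵢ X)) ≤
      ⨆ (Γ' : Subgroup (X ≃ᵢ X)) (_ : Γ' ≤ Γ) (_ : IsSchottkyGroup o Γ'),
        criticalExponent o (Γ' : Set (X ≃ᵢ X)) := by
  by_contra! hlt
  obtain ⟨r, hr, hr'⟩ := EReal.lt_iff_exists_real_btwn.1 hlt
  have hle : ∀ Γ' ≤ Γ, IsSchottkyGroup o Γ' → criticalExponent o (Γ' : Set (X ≃ᵢ X)) < r :=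
    fun Γ' h₁ h₂ => (le_iSup₂_of_le Γ' h₁ (le_iSup (fun _ : IsSchottkyGroup o Γ' =>
      criticalExponent o (Γ' : Set (X ≃ᵢ X))) h₂)).trans_lt hr
  -- The trivial subgroup already gives exponent at least 0, so only positive r remain.
  have hr0 : 0 < r := by
    exact_mod_cast (criticalExponent_nonneg o ⊥).trans_lt (hle ⊥ bot_le (isSchottkyGroup_bot o))
  have h2r : ((2 * r : ℝ) : EReal) < criticalExponent o (Γ : Set (X ≃ᵢ X)) := by
    by_contra! hc
    refine absurd hr' (not_lt.2 ((mul_le_mul_of_nonneg_left hc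
      (by exact_mod_cast (by norm_num : (0 : ℝ) ≤ 1 / 2))).trans_eq ?_))
    rw [← EReal.coe_mul]
    congr 1
    ring
  obtain ⟨s, hs, hs'⟩ := EReal.lt_iff_exists_real_btwn.1 h2r
  have hrs : 2 * r < s := by exact_mod_cast hs
  obtain ⟨δ, h0, hδ⟩ : ∃ δ : ℝ, 0 ≤ δ ∧ HyperbolicWith o δ := id ho
  obtain ⟨g, hgΓ, hg⟩ := hδ.exists_hyperbolic h0 ho
    (unbounded_orbit_of_pos_lt_criticalExponent hdisc (by linarith) hs') hfix
  obtain ⟨Γ', h₁, h₂, h₃⟩ := hδ.exists_schottky h0 hdisc hgΓ hg hrs hs'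
  exact absurd h₃ (not_le.2 (hle Γ' h₁ h₂))
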